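/- Let $n\ge 1$ and let $g$ be a density generator on $\mathbb R^{n+1}$, i.e. $g\ge 0$ on $[0,\infty)$ and $\int_{\mathbb R^{n+1}} g(z'z)\,dz=1$. For $\mu,\alpha_w\in\mathbb R^n$ and a positive definite symmetric matrix $\Omega=(\omega_{ij})\in\mathbb R^{n\times n}$ put $$\omega=\mathrm{diag}(\sqrt{\omega_{11}},\dots,\sqrt{\omega_{nn}}),\quad \delta_w=\frac{\Omega\alpha_w}{\sqrt{1+\alpha_w'\Omega\alpha_w}},\quad \delta=\omega^{-1}\delta_w,\quad \Delta=\mathrm{diag}\bigl(\sqrt{1-\delta_1^2},\dots,\sqrt{1-\delta_n^2}\bigr),\quad \lambda=\Delta^{-1}\delta,\quad \Psi=\Delta^{-1}\omega^{-1}\Omega\,\omega^{-1}\Delta^{-1}.$$ A random vector has the skew-elliptical distribution $SE_n(\mu,\Omega,\alpha_w,g)$ if it is distributed as $\mu+\omega(\delta|U_0|+\Delta U_1)$, where $(U_0,U_1')'$ is an elliptical random vector in $\mathbb R^{1+n}$ with Lebesgue density $|\Psi^*|^{-1/2}g(u'(\Psi^*)^{-1}u)$, $\Psi^*=\begin{pmatrix}1&0\\0&\Psi-\lambda\lambda'\end{pmatrix}$.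 The law of $U_0$ depends only on $n$ and $g$: it is the law of the first coordinate of the spherical random vector with density $z\mapsto g(z'z)$ on $\mathbb R^{n+1}$. For real random variables write $V\le_{cx}W$ if $E\psi(V)\le E\psi(W)$ for every convex $\psi:\mathbb R\to\mathbb R$ for which both expectations exist (are finite); for random vectors in $\mathbb R^n$ write $X\le_{lcx}Y$ if $a'X\le_{cx}a'Y$ for every $a\in\mathbb R^n$. **Theorem.** Let $X\sim SE_n(\mu^x,\Omega^x,\alpha_w^x,g)$ and $Y\sim SE_n(\mu^y,\Omega^y,\alpha_w^y,g)$, with the same $g$, and let $\delta_w^x,\delta_w^y$ be the corresponding vectors $\delta_w$. 1. If $\mu^x=\mu^y$, $\delta_w^x=\delta_w^y$ and $\Omega^y-\Omega^x$ is positive semidefinite, then $X\le_{lcx}Y$. 2. Suppose that $E|U_0|<\infty$ and that $X$ is not almost surely bounded. If $X\le_{lcx}Y$, then $\mu^x+E(|U_0|)\,\delta_w^x=\mu^y+E(|U_0|)\,\delta_w^y$ and $\Omega^y-\Omega^x$ is positive semidefinite. -/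

import Mathlib

open MeasureTheory ProbabilityTheory Matrix

noncomputable section

namespace SkewElliptical

/-- `g` is a density generator on `ℝ^ι`: `z ↦ g (z'z)` is a probability density there. -/
structure IsDensityGenerator (ι : Type*) [Fintype ι] (g : ℝ → ℝ) : Prop where
  measurable : Measurable g
  nonneg : ∀ t, 0 ≤ t → 0 ≤ g t
  lintegral_eq_one : ∫⁻ z : ι → ℝ, ENNReal.ofReal (g (z ⬝ᵥ z)) = 1

/-- The elliptical law `EC(m, S, g)` on `ℝ^ι`, with Lebesgue density
`|S|^{-1/2} g((u - m)' S⁻¹ (u - m))`. -/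
def ellipticalLaw {ι : Type*} [Fintype ι] [DecidableEq ι]
    (m : ι → ℝ) (S : Matrix ι ι ℝ) (g : ℝ → ℝ) : Measure (ι → ℝ) :=
  volume.withDensity fun u =>
    ENNReal.ofReal ((Real.sqrt S.det)⁻¹ * g ((u - m) ⬝ᵥ (S⁻¹ *ᵥ (u - m))))

section Parameters

variable {n : ℕ}

/-- The diagonal of `ω = diag(√ω₁₁, …, √ωₙₙ)`. -/
def scale (Om : Matrix (Fin n) (Fin n) ℝ) : Fin n → ℝ := fun i => Real.sqrt (Om i i)

/-- The skewness vector `δ_w = ω δ = Ω α_w / √(1 + α_w' Ω α_w)`. -/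
def deltaW (Om : Matrix (Fin n) (Fin n) ℝ) (al : Fin n → ℝ) : Fin n → ℝ :=
  (Real.sqrt (1 + al ⬝ᵥ (Om *ᵥ al)))⁻¹ • (Om *ᵥ al)

/-- The normalized skewness vector `δ = ω⁻¹ δ_w`, with entries in `(-1, 1)`. -/
def delta (Om : Matrix (Fin n) (Fin n) ℝ) (al : Fin n → ℝ) : Fin n → ℝ :=
  fun i => deltaW Om al i / scale Om i

/-- The diagonal of `Δ = diag(√(1 - δ₁²), …, √(1 - δₙ²))`. -/
def coDelta (Om : Matrix (Fin n) (Fin n) ℝ) (al : Fin n → ℝ) : Fin n → ℝ :=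
  fun i => Real.sqrt (1 - delta Om al i ^ 2)

/-- `λᵢ = δᵢ (1 - δᵢ²)^{-1/2}`. -/
def lam (Om : Matrix (Fin n) (Fin n) ℝ) (al : Fin n → ℝ) : Fin n → ℝ :=
  fun i => delta Om al i / coDelta Om al i

/-- `Ψ = Δ⁻¹ ω⁻¹ Ω ω⁻¹ Δ⁻¹`, so that `Ω = ω Δ Ψ Δ ω`. -/
def psi (Om : Matrix (Fin n) (Fin n) ℝ) (al : Fin n → ℝ) : Matrix (Fin n) (Fin n) ℝ :=
  Matrix.of fun i j =>
    Om i j / ((scale Om i * coDelta Om al i) * (scale Om j * coDelta Om al j))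

/-- The correlation matrix `Ψ* = diag(1, Ψ - λλ')` of `(U₀, U₁')'`; the index `Sum.inl ()`
belongs to `U₀` and the indices `Sum.inr i` to `U₁`. -/
def psiStar (Om : Matrix (Fin n) (Fin n) ℝ) (al : Fin n → ℝ) :
    Matrix (Unit ⊕ Fin n) (Unit ⊕ Fin n) ℝ :=
  Matrix.fromBlocks 1 0 0 (psi Om al - Matrix.vecMulVec (lam Om al) (lam Om al))

/-- The map `(U₀, U₁) ↦ μ + ω (δ |U₀| + Δ U₁)`. -/
def representation (mu : Fin n → ℝ) (Om : Matrix (Fin n) (Fin n) ℝ) (al : Fin n → ℝ)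
    (u : Unit ⊕ Fin n → ℝ) : Fin n → ℝ :=
  fun i => mu i + scale Om i *
    (delta Om al i * |u (Sum.inl ())| + coDelta Om al i * u (Sum.inr i))

/-- The skew-elliptical law `SE_n(μ, Ω, α_w, g)`: the law of `μ + ω (δ |U₀| + Δ U₁)` for
`(U₀, U₁')' ∼ EC_{n+1}(0, Ψ*, g)`. -/
def skewEllipticalLaw (mu : Fin n → ℝ) (Om : Matrix (Fin n) (Fin n) ℝ) (al : Fin n → ℝ)
    (g : ℝ → ℝ) : Measure (Fin n → ℝ) :=
  (ellipticalLaw 0 (psiStar Om al) g).map (representation mu Om al)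

end Parameters

/-- The law of `U₀`, the first coordinate of the standard spherical vector in `ℝ^{n+1}` with
density generator `g`. (The first coordinate of `EC_{n+1}(0, Ψ*, g)` has this law whatever the
second block of `Ψ*` is.) -/
def lawU0 (n : ℕ) (g : ℝ → ℝ) : Measure ℝ :=
  (ellipticalLaw (0 : Unit ⊕ Fin n → ℝ) 1 g).map fun u => u (Sum.inl ())

/-- `X ≤_cx Y`: `E ψ(X) ≤ E ψ(Y)` for every convex `ψ : ℝ → ℝ` for which both expectations
exist. -/
def ConvexOrder {S T : Type*} [MeasurableSpace S] [MeasurableSpace T]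
    (P : Measure S) (Q : Measure T) (X : S → ℝ) (Y : T → ℝ) : Prop :=
  ∀ ψ : ℝ → ℝ, ConvexOn ℝ Set.univ ψ →
    Integrable (fun s => ψ (X s)) P → Integrable (fun t => ψ (Y t)) Q →
    ∫ s, ψ (X s) ∂P ≤ ∫ t, ψ (Y t) ∂Q

/-- `X ≤_lcx Y`: `a'X ≤_cx a'Y` for every `a ∈ ℝⁿ`. -/
def LinearConvexOrder {n : ℕ} {S T : Type*} [MeasurableSpace S] [MeasurableSpace T]
    (P : Measure S) (Q : Measure T) (X : S → Fin n → ℝ) (Y : T → Fin n → ℝ) : Prop :=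
  ∀ a : Fin n → ℝ, ConvexOrder P Q (fun s => a ⬝ᵥ X s) (fun t => a ⬝ᵥ Y t)

end SkewElliptical

end

/-! With `(U₀, U₁)` spherical and `C C' = Ω - δ_w δ_w'`, X has the law of `μ + |U₀| δ_w + C U₁`
(`exists_skewEllipticalLaw_eq_map`). So `a'X` has the law of `a'μ + b|U₀| + w ⬝ U₁`, where `b =
a'δ_w` and `b² + w ⬝ w = a'Ωa`, and the question becomes one about such scalar variables.

Sufficiency (`convexOrder_add_dotProduct`): μ and b agree and only the length of w grows. Rotating
`U₁` makes the shorter vector a multiple `s v` of the longer one with `0 ≤ s ≤ 1`. Since `U₁` may be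
replaced by `-U₁`, ψ can be averaged over `k ± s z`, and convexity bounds this by the average over
`k ± z`.

Necessity: the identity as test function, for all a, equates the means. For Ω, the even functions of
`b|U₀| + w ⬝ U₁` do not see the skewness: its absolute value has the law of `|r U₀|` with `r² =
a'Ωa` (`integral_max_abs_sub`). If r were larger for X than for Y, a hockey stick `(|x - m| - c)₊`
far enough out would violate the order, because `U₀` is unbounded
(`add_dotProduct_self_le_of_convexOrder`). These test functions grow linearly, so `E|U₀| < ∞` gives
all the expectations. -/

noncomputable section
namespace SkewElliptical

/-! ### Linear images and rotations of spherical laws -/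

section Spherical

variable {ι : Type*} [Fintype ι] [DecidableEq ι] {g : ℝ → ℝ}

/-- An invertible linear image of a spherical law is elliptical. -/
lemma map_mulVec_ellipticalLaw (hg : Measurable g) {B : Matrix ι ι ℝ} (hB : B.det ≠ 0) :
    (ellipticalLaw 0 1 g).map (fun v => B *ᵥ v) = ellipticalLaw 0 (B * Bᵀ) g := by
  have hBm : Measurable (fun v : ι → ℝ => B *ᵥ v) := by fun_prop
  have hvol : (volume : Measure (ι → ℝ)) =
      ENNReal.ofReal |B.det| • (volume : Measure (ι → ℝ)).map (fun v => B *ᵥ v) := by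
    have h := Real.map_matrix_volume_pi_eq_smul_volume_pi hB
    have h' : (volume : Measure (ι → ℝ)).map (fun v => B *ᵥ v) =
        ENNReal.ofReal |B.det⁻¹| • volume := h
    rw [h', smul_smul, ← ENNReal.ofReal_mul (abs_nonneg _), ← abs_mul, mul_inv_cancel₀ hB]
    simp
  have hunit : IsUnit B.det := isUnit_iff_ne_zero.mpr hB
  have hunitT : IsUnit Bᵀ.det := by rwa [det_transpose]
  have key : ∀ v : ι → ℝ, (B *ᵥ v) ⬝ᵥ ((B * Bᵀ)⁻¹ *ᵥ (B *ᵥ v)) = v ⬝ᵥ v := by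
    intro v
    rw [Matrix.mul_inv_rev, mulVec_mulVec, Matrix.mul_assoc, Matrix.nonsing_inv_mul _ hunit,
      Matrix.mul_one, dotProduct_comm, dotProduct_mulVec, vecMul_mulVec,
      ← mulVec_transpose, transpose_mul, transpose_transpose,
      Matrix.mul_nonsing_inv _ hunitT, one_mulVec]
  have hdet : Real.sqrt (B * Bᵀ).det = |B.det| := by
    rw [det_mul, det_transpose, Real.sqrt_mul_self_eq_abs]
  have hpos : 0 < |B.det| := abs_pos.mpr hB
  ext s hs
  rw [Measure.map_apply hBm hs, ellipticalLaw, ellipticalLaw, withDensity_apply _ (hBm hs),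
    withDensity_apply _ hs]
  conv_rhs => rw [hvol]
  rw [Measure.restrict_smul, lintegral_smul_measure, setLIntegral_map hs (by fun_prop) hBm,
    smul_eq_mul, ← lintegral_const_mul _ (by fun_prop)]
  refine lintegral_congr fun v => ?_
  rw [← ENNReal.ofReal_mul (abs_nonneg _)]
  simp only [sub_zero, key, hdet]
  rw [← mul_assoc, mul_inv_cancel₀ hpos.ne']
  simp

/-- Spherical laws are invariant under orthogonal transformations. -/
lemma measurePreserving_mulVec (hg : Measurable g) {B : Matrix ι ι ℝ} (hB : B * Bᵀ = 1) :
    MeasurePreserving (fun v => B *ᵥ v) (ellipticalLaw 0 1 g) (ellipticalLaw 0 1 g) := by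
  refine ⟨by fun_prop, ?_⟩
  rw [map_mulVec_ellipticalLaw hg, hB]
  intro h
  have := congrArg Matrix.det hB
  simp [h] at this

lemma IsDensityGenerator.isProbabilityMeasure (hg : IsDensityGenerator ι g) :
    IsProbabilityMeasure (ellipticalLaw (0 : ι → ℝ) 1 g) := by
  refine ⟨?_⟩
  rw [ellipticalLaw, withDensity_apply _ MeasurableSet.univ]
  simpa using hg.lintegral_eq_one

end Spherical

/-- A Householder reflection carries a vector to any other vector of the same length. -/
lemma exists_orthogonal_mulVec_eq {ι : Type*} [Fintype ι] [DecidableEq ι] {v w : ι → ℝ}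
    (h : v ⬝ᵥ v = w ⬝ᵥ w) : ∃ B : Matrix ι ι ℝ, B * Bᵀ = 1 ∧ Bᵀ *ᵥ v = w := by
  rcases eq_or_ne v w with rfl | hvw
  · exact ⟨1, by simp, by simp⟩
  set d := v - w with hd
  have hd0 : d ⬝ᵥ d ≠ 0 := by
    rw [Ne, dotProduct_self_eq_zero, hd, sub_eq_zero]; exact hvw
  -- Equal lengths of v and w enter here: they make the reflection in the hyperplane orthogonal to d
  -- subtract exactly d from v.
  have hdv : d ⬝ᵥ d = 2 * (d ⬝ᵥ v) := by
    simp only [hd, sub_dotProduct, dotProduct_sub, dotProduct_comm w v]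
    linarith
  have hT : (1 - (2 / (d ⬝ᵥ d)) • vecMulVec d d)ᵀ = 1 - (2 / (d ⬝ᵥ d)) • vecMulVec d d := by
    simp [transpose_vecMulVec]
  refine ⟨1 - (2 / (d ⬝ᵥ d)) • vecMulVec d d, ?_, ?_⟩
  · rw [hT]
    ext i j
    simp only [sub_mul, mul_sub, one_mul, mul_one, Matrix.smul_mul, Matrix.mul_smul,
      vecMulVec_mul_vecMulVec, Matrix.sub_apply, Matrix.smul_apply, smul_eq_mul, vecMulVec_smul]
    field_simp
    ring
  · rw [hT]
    ext i
    simp only [sub_mulVec, one_mulVec, smul_mulVec, vecMulVec_mulVec, Pi.sub_apply,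
      Pi.smul_apply, smul_eq_mul, MulOpposite.smul_eq_mul_unop, MulOpposite.unop_op]
    rw [hdv] at hd0 ⊢
    have : d ⬝ᵥ v ≠ 0 := by rintro h; simp [h] at hd0
    field_simp
    simp [hd]

section Split

variable {n : ℕ} {g : ℝ → ℝ}

/-- Rotations of the second block preserve spherical laws. -/
lemma measurePreserving_elim_mulVec (hg : Measurable g) {B : Matrix (Fin n) (Fin n) ℝ}
    (hB : B * Bᵀ = 1) :
    MeasurePreserving (fun v : Unit ⊕ Fin n → ℝ =>
      Sum.elim (fun _ : Unit => v (Sum.inl ())) (B *ᵥ (v ∘ Sum.inr)))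
      (ellipticalLaw (0 : Unit ⊕ Fin n → ℝ) 1 g) (ellipticalLaw 0 1 g) := by
  have h := measurePreserving_mulVec (ι := Unit ⊕ Fin n) hg (B := fromBlocks 1 0 0 B) (by
    rw [fromBlocks_transpose, fromBlocks_multiply]
    simp [hB])
  convert h using 1
  ext v i
  rw [fromBlocks_mulVec]
  rcases i with i | i <;> simp

/-- The law of `v ⬝ u₁` given `u₀` is symmetric. -/
lemma measurePreserving_neg_inr (hg : Measurable g) :
    MeasurePreserving (fun v : Unit ⊕ Fin n → ℝ =>
      Sum.elim (fun _ : Unit => v (Sum.inl ())) (-(v ∘ Sum.inr)))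
      (ellipticalLaw (0 : Unit ⊕ Fin n → ℝ) 1 g) (ellipticalLaw 0 1 g) := by
  simpa [neg_mulVec] using measurePreserving_elim_mulVec (n := n) hg (B := -1) (by simp)

end Split

/-! ### The residual matrix `Ω - δ_w δ_w'` -/

section Decomposition

variable {n : ℕ}

/-- A symmetric square root of a positive definite matrix. -/
lemma exists_mul_transpose_eq {ι : Type*} [Fintype ι] [DecidableEq ι] {A : Matrix ι ι ℝ}
    (hA : A.PosDef) : ∃ C : Matrix ι ι ℝ, C * Cᵀ = A := by
  open scoped MatrixOrder in
  refine ⟨CFC.sqrt A, ?_⟩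
  have h1 : (CFC.sqrt A)ᵀ = CFC.sqrt A := by
    have := (Matrix.nonneg_iff_posSemidef.mp (CFC.sqrt_nonneg A)).1
    simpa [IsHermitian] using this
  rw [h1]
  exact CFC.sqrt_mul_sqrt_self A (Matrix.nonneg_iff_posSemidef.mpr hA.posSemidef)

/-- `Ω - δ_w δ_w'` is the covariance part of a skew-elliptical law not due to `|U₀|`. -/
def residual (Om : Matrix (Fin n) (Fin n) ℝ) (al : Fin n → ℝ) : Matrix (Fin n) (Fin n) ℝ :=
  Om - vecMulVec (deltaW Om al) (deltaW Om al)

lemma dotProduct_residual_mulVec (Om : Matrix (Fin n) (Fin n) ℝ) (al a : Fin n → ℝ) :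
    a ⬝ᵥ (residual Om al *ᵥ a) = a ⬝ᵥ (Om *ᵥ a) - (a ⬝ᵥ deltaW Om al) ^ 2 := by
  rw [residual, sub_mulVec, dotProduct_sub, vecMulVec_mulVec, dotProduct_comm _ a]
  simp [sq]

/-- Cauchy–Schwarz in the inner product of Ω gives `(x'Ωα)² ≤ (x'Ωx)(α'Ωα)`; the extra 1 in the
normalization of `δ_w` makes the resulting inequality strict. -/
lemma posDef_residual {Om : Matrix (Fin n) (Fin n) ℝ} (hOm : Om.PosDef) (al : Fin n → ℝ) :
    (residual Om al).PosDef := by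
  refine .of_dotProduct_mulVec_pos ?_ fun x hx => ?_
  · have : (vecMulVec (deltaW Om al) (deltaW Om al)).IsHermitian := by
      simp [IsHermitian, transpose_vecMulVec]
    exact hOm.1.sub this
  rw [star_trivial, dotProduct_residual_mulVec]
  have hxx : 0 < x ⬝ᵥ (Om *ᵥ x) := by simpa using hOm.dotProduct_mulVec_pos hx
  have haa : 0 ≤ al ⬝ᵥ (Om *ᵥ al) := by simpa using hOm.posSemidef.dotProduct_mulVec_nonneg al
  have hcs : (x ⬝ᵥ (Om *ᵥ al)) ^ 2 ≤ (x ⬝ᵥ (Om *ᵥ x)) * (al ⬝ᵥ (Om *ᵥ al)) := by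
    obtain ⟨C, rfl⟩ := exists_mul_transpose_eq hOm
    have h : ∀ y z : Fin n → ℝ, y ⬝ᵥ ((C * Cᵀ) *ᵥ z) = (Cᵀ *ᵥ y) ⬝ᵥ (Cᵀ *ᵥ z) := fun y z => by
      rw [← mulVec_mulVec, dotProduct_mulVec, mulVec_transpose C y]
    simp only [h]
    simpa [dotProduct, sq] using
      Finset.sum_mul_sq_le_sq_mul_sq Finset.univ (Cᵀ *ᵥ x) (Cᵀ *ᵥ al)
  rw [deltaW, dotProduct_smul, smul_eq_mul, mul_pow, inv_pow, Real.sq_sqrt (by positivity),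
    sub_pos, inv_mul_lt_iff₀ (by positivity)]
  nlinarith

end Decomposition

/-! ### The stochastic representation -/

section Stochastic

variable {n : ℕ} {g : ℝ → ℝ}

lemma scale_pos {Om : Matrix (Fin n) (Fin n) ℝ} (hOm : Om.PosDef) (i : Fin n) :
    0 < scale Om i := Real.sqrt_pos.mpr hOm.diag_pos

/-- The i-th diagonal entry of the residual is `ωᵢᵢ (1 - δᵢ²)`, and it is positive. -/
lemma coDelta_pos {Om : Matrix (Fin n) (Fin n) ℝ} (hOm : Om.PosDef) (al : Fin n → ℝ)
    (i : Fin n) : 0 < coDelta Om al i := by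
  have h : 0 < residual Om al i i := (posDef_residual hOm al).diag_pos
  simp only [residual, Matrix.sub_apply, vecMulVec_apply] at h
  refine Real.sqrt_pos.mpr ?_
  rw [delta, div_pow, scale, Real.sq_sqrt hOm.diag_pos.le, sub_pos, div_lt_one hOm.diag_pos]
  linarith

/-- The stochastic representation `X = μ + |U₀| δ_w + C U₁` of a skew-elliptical vector, where
`(U₀, U₁)` is spherical and `C C' = Ω - δ_w δ_w'`. -/
lemma exists_skewEllipticalLaw_eq_map (hg : Measurable g) {Om : Matrix (Fin n) (Fin n) ℝ}
    (hOm : Om.PosDef) (mu al : Fin n → ℝ) :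
    ∃ C : Matrix (Fin n) (Fin n) ℝ, C * Cᵀ = residual Om al ∧
      skewEllipticalLaw mu Om al g = (ellipticalLaw (0 : Unit ⊕ Fin n → ℝ) 1 g).map
        (fun v => mu + |v (Sum.inl ())| • deltaW Om al + C *ᵥ (v ∘ Sum.inr)) := by
  set e : Fin n → ℝ := fun i => scale Om i * coDelta Om al i with he
  have he0 : ∀ i, e i ≠ 0 := fun i => (mul_pos (scale_pos hOm i) (coDelta_pos hOm al i)).ne'
  -- Conjugating by `ωΔ` turns `Ψ - λλ'` into the residual, so a square root of one rescales to a
  -- factor of the other.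
  have hN : psi Om al - vecMulVec (lam Om al) (lam Om al) =
      diagonal e⁻¹ * residual Om al * diagonal e⁻¹ := by
    ext i j
    have h1 := (scale_pos hOm i).ne'
    have h2 := (scale_pos hOm j).ne'
    have h3 := (coDelta_pos hOm al i).ne'
    have h4 := (coDelta_pos hOm al j).ne'
    simp only [Matrix.sub_apply, psi, of_apply, vecMulVec_apply, lam, delta, residual,
      mul_diagonal, diagonal_mul, Pi.inv_apply, he]
    field_simp
  have hNpos : (diagonal e⁻¹ * residual Om al * diagonal e⁻¹).PosDef := by
    have h := (posDef_residual hOm al).mul_mul_conjTranspose_same (B := diagonal e⁻¹) (by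
      intro x y hxy
      ext i
      have := congrFun hxy i
      simpa [vecMul_diagonal, he0 i] using this)
    simpa [diagonal_conjTranspose] using h
  obtain ⟨C, hC⟩ := exists_mul_transpose_eq hNpos
  have hCdet : C.det ≠ 0 := by
    intro h
    have := hNpos.det_pos
    simp [← hC, h] at this
  refine ⟨diagonal e * C, ?_, ?_⟩
  · rw [transpose_mul, diagonal_transpose, Matrix.mul_assoc, ← Matrix.mul_assoc C, hC]
    ext i j
    simp only [mul_diagonal, diagonal_mul, Pi.inv_apply]
    have := he0 i
    have := he0 j
    field_simp
  · have hstar : psiStar Om al = fromBlocks 1 0 0 C * (fromBlocks 1 0 0 C)ᵀ := by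
      rw [psiStar, hN, ← hC, fromBlocks_transpose, fromBlocks_multiply]
      simp
    rw [skewEllipticalLaw, hstar, ← map_mulVec_ellipticalLaw hg (by simpa using hCdet),
      Measure.map_map (by unfold representation; fun_prop) (by fun_prop)]
    congr 1
    ext v i
    have h1 := (scale_pos hOm i).ne'
    simp only [Function.comp_apply, representation, fromBlocks_mulVec, Sum.elim_inl, Sum.elim_inr,
      Pi.add_apply, Pi.smul_apply, smul_eq_mul, ← mulVec_mulVec, mulVec_diagonal, he, delta,
      zero_mulVec, one_mulVec, add_zero, zero_add]
    field_simp
    ring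

/-- Linear functionals of a skew-elliptical vector. -/
lemma exists_map_dotProduct_eq {S : Type*} [MeasurableSpace S] {P : Measure S}
    (hg : Measurable g) {Om : Matrix (Fin n) (Fin n) ℝ} (hOm : Om.PosDef) {mu al : Fin n → ℝ}
    {X : S → Fin n → ℝ} (hX : HasLaw X (skewEllipticalLaw mu Om al g) P) (a : Fin n → ℝ) :
    ∃ w : Fin n → ℝ, w ⬝ᵥ w = a ⬝ᵥ (Om *ᵥ a) - (a ⬝ᵥ deltaW Om al) ^ 2 ∧
      P.map (fun s => a ⬝ᵥ X s) = (ellipticalLaw (0 : Unit ⊕ Fin n → ℝ) 1 g).map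
        (fun v => a ⬝ᵥ mu + (a ⬝ᵥ deltaW Om al) * |v (Sum.inl ())| + w ⬝ᵥ (v ∘ Sum.inr)) := by
  obtain ⟨C, hC, hlaw⟩ := exists_skewEllipticalLaw_eq_map hg hOm mu al
  refine ⟨Cᵀ *ᵥ a, ?_, ?_⟩
  · rw [← dotProduct_residual_mulVec, ← hC, ← mulVec_mulVec, dotProduct_mulVec a,
      mulVec_transpose]
  · have h : P.map (fun s => a ⬝ᵥ X s) = (P.map X).map (fun x => a ⬝ᵥ x) := by
      rw [AEMeasurable.map_map_of_aemeasurable (by fun_prop) hX.aemeasurable]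
      rfl
    rw [h, hX.map_eq, hlaw, Measure.map_map (by fun_prop) (by fun_prop)]
    congr 1
    ext v
    simp [dotProduct_add, dotProduct_mulVec, mulVec_transpose, mul_comm]

end Stochastic

lemma continuous_of_convexOn_univ {ψ : ℝ → ℝ} (hψ : ConvexOn ℝ Set.univ ψ) : Continuous ψ :=
  continuousOn_univ.mp (hψ.continuousOn isOpen_univ)

/-- The convex order depends only on the laws of the variables. -/
lemma convexOrder_congr {S T S' T' : Type*} [MeasurableSpace S] [MeasurableSpace T]
    [MeasurableSpace S'] [MeasurableSpace T'] {P : Measure S} {Q : Measure T} {P' : Measure S'}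
    {Q' : Measure T'} {X : S → ℝ} {Y : T → ℝ} {X' : S' → ℝ} {Y' : T' → ℝ}
    (hX : AEMeasurable X P) (hY : AEMeasurable Y Q) (hX' : AEMeasurable X' P')
    (hY' : AEMeasurable Y' Q') (hXX' : P.map X = P'.map X') (hYY' : Q.map Y = Q'.map Y') :
    ConvexOrder P Q X Y ↔ ConvexOrder P' Q' X' Y' := by
  refine forall_congr' fun ψ => forall_congr' fun hψ => ?_
  have hc : ∀ μ : Measure ℝ, AEStronglyMeasurable ψ μ := fun μ =>
    (continuous_of_convexOn_univ hψ).aestronglyMeasurable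
  have h1 : Integrable (fun s => ψ (X s)) P ↔ Integrable (fun s => ψ (X' s)) P' := by
    have a := integrable_map_measure (hc _) hX
    have b := integrable_map_measure (hc _) hX'
    rw [hXX'] at a
    exact a.symm.trans b
  have h2 : Integrable (fun s => ψ (Y s)) Q ↔ Integrable (fun s => ψ (Y' s)) Q' := by
    have a := integrable_map_measure (hc _) hY
    have b := integrable_map_measure (hc _) hY'
    rw [hYY'] at a
    exact a.symm.trans b
  have h3 : ∫ s, ψ (X s) ∂P = ∫ s, ψ (X' s) ∂P' := by
    rw [← integral_map hX (hc _), hXX', integral_map hX' (hc _)]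
  have h4 : ∫ s, ψ (Y s) ∂Q = ∫ s, ψ (Y' s) ∂Q' := by
    rw [← integral_map hY (hc _), hYY', integral_map hY' (hc _)]
  rw [h1, h2, h3, h4]

/-- Both `k ± s z` are convex combinations of `k ± z`, with the weights `(1 + s)/2` and `(1 - s)/2`
interchanged; the two inequalities add up. -/
lemma add_symm_le_of_convexOn {ψ : ℝ → ℝ} (hψ : ConvexOn ℝ Set.univ ψ) {s : ℝ} (hs0 : 0 ≤ s)
    (hs1 : s ≤ 1) (k z : ℝ) : ψ (k + s * z) + ψ (k + (-s) * z) ≤ ψ (k + z) + ψ (k + (-1) * z) := by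
  have h1 := hψ.2 (Set.mem_univ (k + z)) (Set.mem_univ (k + (-1) * z))
    (show 0 ≤ (1 + s) / 2 by linarith) (show 0 ≤ (1 - s) / 2 by linarith) (by ring)
  have h2 := hψ.2 (Set.mem_univ (k + z)) (Set.mem_univ (k + (-1) * z))
    (show 0 ≤ (1 - s) / 2 by linarith) (show 0 ≤ (1 + s) / 2 by linarith) (by ring)
  simp only [smul_eq_mul] at h1 h2
  rw [show (1 + s) / 2 * (k + z) + (1 - s) / 2 * (k + (-1) * z) = k + s * z by ring] at h1
  rw [show (1 - s) / 2 * (k + z) + (1 + s) / 2 * (k + (-1) * z) = k + (-s) * z by ring] at h2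
  linarith

/-! ### One-dimensional marginals of spherical laws -/

section Spherical

variable {ι : Type*} [Fintype ι] [DecidableEq ι] {g : ℝ → ℝ}

/-- The law of a linear functional of a spherical vector depends only on its norm. -/
lemma map_dotProduct_ellipticalLaw (hg : Measurable g) (w : ι → ℝ) (i : ι) :
    (ellipticalLaw 0 1 g).map (fun v => w ⬝ᵥ v) =
      (ellipticalLaw 0 1 g).map (fun v => Real.sqrt (w ⬝ᵥ w) * v i) := by
  -- Rotate w onto the i-th axis.
  obtain ⟨B, hB, hBw⟩ := exists_orthogonal_mulVec_eq (v := w)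
    (w := Pi.single i (Real.sqrt (w ⬝ᵥ w))) (by
      have : 0 ≤ w ⬝ᵥ w := by simpa using dotProduct_star_self_nonneg w
      simp [Real.mul_self_sqrt this])
  conv_lhs => rw [← (measurePreserving_mulVec hg hB).map_eq]
  rw [Measure.map_map (by fun_prop) (by fun_prop)]
  congr 1
  ext v
  simp [dotProduct_mulVec, ← mulVec_transpose, hBw]

lemma integrable_dotProduct (hg : Measurable g) {i : ι}
    (hi : Integrable (fun v : ι → ℝ => |v i|) (ellipticalLaw 0 1 g)) (w : ι → ℝ) :
    Integrable (fun v : ι → ℝ => w ⬝ᵥ v) (ellipticalLaw 0 1 g) := by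
  have hi' : Integrable (fun v : ι → ℝ => v i) (ellipticalLaw 0 1 g) :=
    (integrable_norm_iff (measurable_pi_apply _).aestronglyMeasurable).mp hi
  have h : Integrable (fun x : ℝ => x) ((ellipticalLaw 0 1 g).map fun v => w ⬝ᵥ v) := by
    have hmr : Measurable (fun v : ι → ℝ => Real.sqrt (w ⬝ᵥ w) * v i) :=
      (measurable_pi_apply i).const_mul _
    rw [map_dotProduct_ellipticalLaw hg w i,
      integrable_map_measure (by fun_prop) hmr.aemeasurable]
    exact hi'.const_mul _
  exact (integrable_map_measure (g := fun x : ℝ => x) (by fun_prop)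
    (f := fun v : ι → ℝ => w ⬝ᵥ v) (by fun_prop)).mp h

/-- All coordinates of a spherical vector have the same law. -/
lemma ae_abs_le_of_ae_abs_le (hg : Measurable g) {i : ι} {K : ℝ}
    (hi : ∀ᵐ v ∂(ellipticalLaw (0 : ι → ℝ) 1 g), |v i| ≤ K) :
    ∀ᵐ v ∂(ellipticalLaw (0 : ι → ℝ) 1 g), ∀ j, |v j| ≤ K := by
  refine ae_all_iff.mpr fun j => ?_
  have hmeas : MeasurableSet {x : ℝ | |x| ≤ K} := measurableSet_le (by fun_prop) (by fun_prop)
  have h : ∀ᵐ x ∂((ellipticalLaw (0 : ι → ℝ) 1 g).map fun v => Pi.single j 1 ⬝ᵥ v), |x| ≤ K := by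
    have hmr : Measurable (fun v : ι → ℝ =>
        Real.sqrt (Pi.single j (1 : ℝ) ⬝ᵥ Pi.single j 1) * v i) :=
      (measurable_pi_apply i).const_mul _
    rw [map_dotProduct_ellipticalLaw hg _ i, ae_map_iff hmr.aemeasurable hmeas]
    simpa using hi
  rw [ae_map_iff (by fun_prop) hmeas] at h
  simpa using h

end Spherical

/-! ### Convex order and even functions of `b|U₀| + w ⬝ U₁` -/

section Split

variable {n : ℕ} {g : ℝ → ℝ}

/-- Enlarging the symmetric part of `c + b |U₀| + w ⬝ U₁` increases it in convex order. -/
lemma convexOrder_add_dotProduct (hg : Measurable g) (c b : ℝ) {w v : Fin n → ℝ}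
    (hwv : w ⬝ᵥ w ≤ v ⬝ᵥ v) :
    ConvexOrder (ellipticalLaw (0 : Unit ⊕ Fin n → ℝ) 1 g)
      (ellipticalLaw (0 : Unit ⊕ Fin n → ℝ) 1 g)
      (fun u => c + b * |u (Sum.inl ())| + w ⬝ᵥ (u ∘ Sum.inr))
      (fun u => c + b * |u (Sum.inl ())| + v ⬝ᵥ (u ∘ Sum.inr)) := by
  intro ψ hψ hiw hiv
  have hψc := continuous_of_convexOn_univ hψ
  have hw0 : 0 ≤ w ⬝ᵥ w := by simpa using dotProduct_star_self_nonneg w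
  obtain ⟨s, hs0, hs1, hs⟩ : ∃ s : ℝ, 0 ≤ s ∧ s ≤ 1 ∧ w ⬝ᵥ w = (s • v) ⬝ᵥ (s • v) := by
    -- The ratio of the lengths. If v is zero then so is w, and the convention `x / 0 = 0` gives the
    -- valid choice `s = 0`.
    refine ⟨Real.sqrt (w ⬝ᵥ w / v ⬝ᵥ v), Real.sqrt_nonneg _, ?_, ?_⟩
    · rw [Real.sqrt_le_one]
      exact div_le_one_of_le₀ hwv (hw0.trans hwv)
    · rw [smul_dotProduct, dotProduct_smul, smul_smul, smul_eq_mul,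
        Real.mul_self_sqrt (div_nonneg hw0 (hw0.trans hwv))]
      rcases eq_or_ne (v ⬝ᵥ v) 0 with h | h
      · rw [h] at hwv ⊢
        linarith
      · field_simp
  obtain ⟨B, hB, hBw⟩ := exists_orthogonal_mulVec_eq hs
  set F : ℝ → (Unit ⊕ Fin n → ℝ) → ℝ := fun k u =>
    ψ (c + b * |u (Sum.inl ())| + k * (v ⬝ᵥ (u ∘ Sum.inr))) with hF
  have hFc : ∀ k, AEStronglyMeasurable (F k) (ellipticalLaw (0 : Unit ⊕ Fin n → ℝ) 1 g) :=
    fun k => Continuous.aestronglyMeasurable (by simp only [hF]; fun_prop)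
  have hneg : ∀ k, (F k) ∘ (fun u : Unit ⊕ Fin n → ℝ =>
      Sum.elim (fun _ : Unit => u (Sum.inl ())) (-(u ∘ Sum.inr))) = F (-k) := by
    intro k
    ext u
    simp [hF]
  have hflip := measurePreserving_neg_inr (n := n) hg
  have hrot := measurePreserving_elim_mulVec hg hB
  have hcomp : (fun u : Unit ⊕ Fin n → ℝ =>
      ψ (c + b * |u (Sum.inl ())| + w ⬝ᵥ (u ∘ Sum.inr))) ∘ (fun u : Unit ⊕ Fin n → ℝ =>
      Sum.elim (fun _ : Unit => u (Sum.inl ())) (B *ᵥ (u ∘ Sum.inr))) = F s := by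
    ext u
    simp [hF, dotProduct_mulVec, ← mulVec_transpose, hBw]
  have hwm := hiw.aestronglyMeasurable
  have hFs : Integrable (F s) (ellipticalLaw (0 : Unit ⊕ Fin n → ℝ) 1 g) := by
    rw [← hcomp]
    exact (hrot.integrable_comp hwm).mpr hiw
  have hF1 : Integrable (F 1) (ellipticalLaw (0 : Unit ⊕ Fin n → ℝ) 1 g) := by
    simpa [hF] using hiv
  have hFn : ∀ k, Integrable (F k) (ellipticalLaw (0 : Unit ⊕ Fin n → ℝ) 1 g) →
      Integrable (F (-k)) (ellipticalLaw (0 : Unit ⊕ Fin n → ℝ) 1 g) := fun k hk => by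
    rw [← hneg k]
    exact (hflip.integrable_comp (hFc k)).mpr hk
  have hIn : ∀ k, ∫ u, F (-k) u ∂(ellipticalLaw (0 : Unit ⊕ Fin n → ℝ) 1 g) =
      ∫ u, F k u ∂(ellipticalLaw (0 : Unit ⊕ Fin n → ℝ) 1 g) := fun k => by
    rw [← hneg k]
    exact hflip.hasLaw.integral_comp (hFc k)
  have hIw := hrot.hasLaw.integral_comp hwm
  rw [hcomp] at hIw
  have hmono : ∫ u, (F s u + F (-s) u) ∂(ellipticalLaw (0 : Unit ⊕ Fin n → ℝ) 1 g) ≤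
      ∫ u, (F 1 u + F (-1) u) ∂(ellipticalLaw (0 : Unit ⊕ Fin n → ℝ) 1 g) := by
    refine integral_mono (hFs.add (hFn s hFs)) (hF1.add (hFn 1 hF1)) fun u => ?_
    simpa [hF] using add_symm_le_of_convexOn hψ hs0 hs1 (c + b * |u (Sum.inl ())|)
      (v ⬝ᵥ (u ∘ Sum.inr))
  rw [integral_add hFs (hFn s hFs), integral_add hF1 (hFn 1 hF1), hIn, hIn] at hmono
  have hI1 : ∫ u, F 1 u ∂(ellipticalLaw (0 : Unit ⊕ Fin n → ℝ) 1 g) =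
      ∫ u, ψ (c + b * |u (Sum.inl ())| + v ⬝ᵥ (u ∘ Sum.inr))
        ∂(ellipticalLaw (0 : Unit ⊕ Fin n → ℝ) 1 g) := by simp [hF]
  rw [← hI1, ← hIw]
  linarith

lemma integrable_dotProduct_inr (hg : Measurable g)
    (hU : Integrable (fun u : Unit ⊕ Fin n → ℝ => |u (Sum.inl ())|) (ellipticalLaw 0 1 g))
    (w : Fin n → ℝ) : Integrable (fun u : Unit ⊕ Fin n → ℝ => w ⬝ᵥ (u ∘ Sum.inr))
      (ellipticalLaw 0 1 g) := by
  have h := integrable_dotProduct hg hU (Sum.elim (fun _ : Unit => 0) w)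
  refine h.congr (.of_forall fun u => ?_)
  simp [dotProduct]

/-- The flip `U₁ ↦ -U₁` preserves the law and negates the integrand. -/
lemma integral_dotProduct_inr (hg : Measurable g) (w : Fin n → ℝ) :
    ∫ u, w ⬝ᵥ (u ∘ Sum.inr) ∂(ellipticalLaw (0 : Unit ⊕ Fin n → ℝ) 1 g) = 0 := by
  have h := (measurePreserving_neg_inr (n := n) hg).hasLaw.integral_comp
    (f := fun u => w ⬝ᵥ (u ∘ Sum.inr)) (Continuous.aestronglyMeasurable (by fun_prop))
  simp only [Function.comp_def, Sum.elim_inr, Pi.neg_apply] at h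
  have h2 : ∀ u : Unit ⊕ Fin n → ℝ, (w ⬝ᵥ fun x => -u (Sum.inr x)) =
      -(w ⬝ᵥ fun x => u (Sum.inr x)) := fun u => dotProduct_neg w _
  simp only [h2, integral_neg] at h
  simp only [Function.comp_def]
  linarith

lemma integrable_max_abs_sub {Ω : Type*} [MeasurableSpace Ω] {P : Measure Ω} [IsFiniteMeasure P]
    {f : Ω → ℝ} (hf : Integrable f P) (c : ℝ) : Integrable (fun x => max (|f x| - c) 0) P :=
  (hf.abs.sub (integrable_const c)).pos_part

/-- Even functions do not see the skewness: `|b |U₀| + w ⬝ U₁|` has the law of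
`|r U₀|` with `r² = b² + w ⬝ w`. -/
lemma integral_max_abs_sub (hg : IsDensityGenerator (Unit ⊕ Fin n) g)
    (hU : Integrable (fun u : Unit ⊕ Fin n → ℝ => |u (Sum.inl ())|) (ellipticalLaw 0 1 g))
    (b c : ℝ) (w : Fin n → ℝ) :
    ∫ u, max (|b * |u (Sum.inl ())| + w ⬝ᵥ (u ∘ Sum.inr)| - c) 0
        ∂(ellipticalLaw (0 : Unit ⊕ Fin n → ℝ) 1 g) =
      ∫ u, max (|Real.sqrt (b ^ 2 + w ⬝ᵥ w) * u (Sum.inl ())| - c) 0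
        ∂(ellipticalLaw (0 : Unit ⊕ Fin n → ℝ) 1 g) := by
  have := hg.isProbabilityMeasure
  have hm := hg.measurable
  set h : ℝ → ℝ := fun x => max (|x| - c) 0 with hh
  have hhc : Continuous h := by fun_prop
  have heven : ∀ x, h (-x) = h x := fun x => by simp [hh]
  have hflip := measurePreserving_neg_inr (n := n) hm
  have hU' : Integrable (fun u : Unit ⊕ Fin n → ℝ => u (Sum.inl ())) (ellipticalLaw 0 1 g) :=
    (integrable_norm_iff (measurable_pi_apply _).aestronglyMeasurable).mp hU
  have hflipI : ∀ f : ℝ → ℝ, Continuous f →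
      ∫ u, h (f (u (Sum.inl ())) + (-w) ⬝ᵥ (u ∘ Sum.inr))
        ∂(ellipticalLaw (0 : Unit ⊕ Fin n → ℝ) 1 g) =
      ∫ u, h (f (u (Sum.inl ())) + w ⬝ᵥ (u ∘ Sum.inr))
        ∂(ellipticalLaw (0 : Unit ⊕ Fin n → ℝ) 1 g) := by
    intro f hf
    rw [← hflip.hasLaw.integral_comp
      (f := fun u => h (f (u (Sum.inl ())) + w ⬝ᵥ (u ∘ Sum.inr)))
      (Continuous.aestronglyMeasurable (by fun_prop))]
    refine integral_congr_ae (.of_forall fun u => ?_)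
    simp
  -- Where `U₀ ≥ 0` the summands agree one by one; where `U₀ ≤ 0` evenness of `h` interchanges them.
  -- Symmetrizing in w thus removes the absolute value.
  have hsum : ∫ u, (h (b * |u (Sum.inl ())| + w ⬝ᵥ (u ∘ Sum.inr)) +
        h (b * |u (Sum.inl ())| + (-w) ⬝ᵥ (u ∘ Sum.inr)))
        ∂(ellipticalLaw (0 : Unit ⊕ Fin n → ℝ) 1 g) =
      ∫ u, (h (b * u (Sum.inl ()) + w ⬝ᵥ (u ∘ Sum.inr)) +
        h (b * u (Sum.inl ()) + (-w) ⬝ᵥ (u ∘ Sum.inr)))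
        ∂(ellipticalLaw (0 : Unit ⊕ Fin n → ℝ) 1 g) := by
    refine integral_congr_ae (.of_forall fun u => ?_)
    rcases le_total 0 (u (Sum.inl ())) with hu | hu
    · simp only [abs_of_nonneg hu]
    · simp only [abs_of_nonpos hu, neg_dotProduct]
      rw [← heven (b * u (Sum.inl ()) + w ⬝ᵥ (u ∘ Sum.inr)),
        ← heven (b * u (Sum.inl ()) + -(w ⬝ᵥ (u ∘ Sum.inr))), add_comm]
      congr 2 <;> ring
  have hi1 : ∀ v : Fin n → ℝ, Integrable (fun u : Unit ⊕ Fin n → ℝ =>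
      h (b * |u (Sum.inl ())| + v ⬝ᵥ (u ∘ Sum.inr))) (ellipticalLaw 0 1 g) := fun v =>
    integrable_max_abs_sub ((hU.const_mul b).add (integrable_dotProduct_inr hm hU v)) c
  have hi2 : ∀ v : Fin n → ℝ, Integrable (fun u : Unit ⊕ Fin n → ℝ =>
      h (b * u (Sum.inl ()) + v ⬝ᵥ (u ∘ Sum.inr))) (ellipticalLaw 0 1 g) := fun v =>
    integrable_max_abs_sub ((hU'.const_mul b).add (integrable_dotProduct_inr hm hU v)) c
  rw [integral_add (hi1 _) (hi1 _), integral_add (hi2 _) (hi2 _),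
    hflipI (fun x => b * |x|) (by fun_prop), hflipI (fun x => b * x) (by fun_prop)] at hsum
  -- Without the absolute value the variable is the linear functional `(b, w)` of a spherical
  -- vector.
  have hlaw := map_dotProduct_ellipticalLaw hm (Sum.elim (fun _ : Unit => b) w) (Sum.inl ())
  have e1 : (fun u : Unit ⊕ Fin n → ℝ => Sum.elim (fun _ : Unit => b) w ⬝ᵥ u) =
      fun u => b * u (Sum.inl ()) + w ⬝ᵥ (u ∘ Sum.inr) := by
    ext u
    simp [dotProduct]
  have e2 : Sum.elim (fun _ : Unit => b) w ⬝ᵥ Sum.elim (fun _ : Unit => b) w =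
      b ^ 2 + w ⬝ᵥ w := by
    simp [dotProduct, sq]
  rw [e1, e2] at hlaw
  have hmr : Measurable (fun u : Unit ⊕ Fin n → ℝ =>
      Real.sqrt (b ^ 2 + w ⬝ᵥ w) * u (Sum.inl ())) := (measurable_pi_apply _).const_mul _
  have hint := congrArg (fun μ => ∫ x, h x ∂μ) hlaw
  rw [integral_map (by fun_prop) hhc.aestronglyMeasurable,
    integral_map hmr.aemeasurable hhc.aestronglyMeasurable] at hint
  simp only [hh] at hint hsum ⊢
  linarith

end Split

/-- For `r < R`, the hockey stick `(R t - c)₊` dominates `(r t - c + D)₊` for a suitable `c`,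
strictly so for large `t`. -/
lemma exists_max_sub_le {r R D : ℝ} (hr : 0 ≤ r) (hrR : r < R) (hD : 0 ≤ D) :
    ∃ c K : ℝ, ∀ t, 0 ≤ t → max (r * t - (c - D)) 0 ≤ max (R * t - c) 0 ∧
      (max (r * t - (c - D)) 0 = max (R * t - c) 0 → t ≤ K) := by
  have hR : 0 < R := hr.trans_lt hrR
  set z := D / (R - r) with hz
  have hz' : z * (R - r) = D := div_mul_cancel₀ _ (by linarith)
  have hz0 : 0 ≤ z := div_nonneg hD (by linarith)
  -- Since `D + r z = R z`, both affine functions vanish at z: the two hockey sticks are 0 up to z,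
  -- and the steeper one wins beyond. Both entries of the maximum equal z.
  refine ⟨D + r * z, max z ((D + r * z) / R), fun t ht => ?_⟩
  have hlt : ∀ t, z < t → r * t - (D + r * z - D) < R * t - (D + r * z) := fun t ht => by
    nlinarith
  refine ⟨max_le ?_ (le_max_right _ _), fun heq => ?_⟩
  · rcases le_or_gt t z with h | h
    · exact le_max_of_le_right (by nlinarith)
    · exact le_max_of_le_left (hlt t h).le
  · by_contra! h
    obtain ⟨h1, h2⟩ := max_lt_iff.mp h
    rw [div_lt_iff₀ hR] at h2
    have h3 : max (r * t - (D + r * z - D)) 0 < R * t - (D + r * z) :=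
      max_lt (hlt t h1) (by linarith)
    exact absurd heq (h3.trans_le (le_max_left _ _)).ne

/-! ### Necessary conditions for the convex order -/

section Necessity

variable {n : ℕ} {g : ℝ → ℝ}

lemma aemeasurable_add_dotProduct (μ : Measure (Unit ⊕ Fin n → ℝ)) (m b : ℝ) (w : Fin n → ℝ) :
    AEMeasurable (fun u => m + b * |u (Sum.inl ())| + w ⬝ᵥ (u ∘ Sum.inr)) μ :=
  (Continuous.measurable (by fun_prop)).aemeasurable

lemma integrable_add_dotProduct (hg : IsDensityGenerator (Unit ⊕ Fin n) g)
    (hU : Integrable (fun u : Unit ⊕ Fin n → ℝ => |u (Sum.inl ())|) (ellipticalLaw 0 1 g))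
    (m b : ℝ) (w : Fin n → ℝ) :
    Integrable (fun u : Unit ⊕ Fin n → ℝ => m + b * |u (Sum.inl ())| + w ⬝ᵥ (u ∘ Sum.inr))
      (ellipticalLaw 0 1 g) := by
  have := hg.isProbabilityMeasure
  exact ((integrable_const m).add (hU.const_mul b)).add
    (integrable_dotProduct_inr hg.measurable hU w)

lemma integral_add_dotProduct (hg : IsDensityGenerator (Unit ⊕ Fin n) g)
    (hU : Integrable (fun u : Unit ⊕ Fin n → ℝ => |u (Sum.inl ())|) (ellipticalLaw 0 1 g))
    (m b : ℝ) (w : Fin n → ℝ) :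
    ∫ u, (m + b * |u (Sum.inl ())| + w ⬝ᵥ (u ∘ Sum.inr))
        ∂(ellipticalLaw (0 : Unit ⊕ Fin n → ℝ) 1 g) =
      m + b * ∫ u, |u (Sum.inl ())| ∂(ellipticalLaw (0 : Unit ⊕ Fin n → ℝ) 1 g) := by
  have := hg.isProbabilityMeasure
  rw [integral_add (f := fun u : Unit ⊕ Fin n → ℝ => m + b * |u (Sum.inl ())|)
      ((integrable_const m).add (hU.const_mul b)) (integrable_dotProduct_inr hg.measurable hU w),
    integral_add (integrable_const m) (hU.const_mul b), integral_const_mul,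
    integral_dotProduct_inr hg.measurable]
  simp

/-- If the radial part is unbounded, the convex order forces `b² + w ⬝ w` to increase. -/
lemma add_dotProduct_self_le_of_convexOrder (hg : IsDensityGenerator (Unit ⊕ Fin n) g)
    (hU : Integrable (fun u : Unit ⊕ Fin n → ℝ => |u (Sum.inl ())|) (ellipticalLaw 0 1 g))
    (hunb : ∀ K : ℝ, ¬ ∀ᵐ u ∂(ellipticalLaw (0 : Unit ⊕ Fin n → ℝ) 1 g), |u (Sum.inl ())| ≤ K)
    {m m' b b' : ℝ} {w w' : Fin n → ℝ}
    (h : ConvexOrder (ellipticalLaw (0 : Unit ⊕ Fin n → ℝ) 1 g)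
      (ellipticalLaw (0 : Unit ⊕ Fin n → ℝ) 1 g)
      (fun u => m + b * |u (Sum.inl ())| + w ⬝ᵥ (u ∘ Sum.inr))
      (fun u => m' + b' * |u (Sum.inl ())| + w' ⬝ᵥ (u ∘ Sum.inr))) :
    b ^ 2 + w ⬝ᵥ w ≤ b' ^ 2 + w' ⬝ᵥ w' := by
  have := hg.isProbabilityMeasure
  by_contra! hlt
  have hw'0 : 0 ≤ w' ⬝ᵥ w' := by simpa using dotProduct_star_self_nonneg w'
  have hsq := Real.sqrt_lt_sqrt (by positivity) hlt
  set R := Real.sqrt (b ^ 2 + w ⬝ᵥ w) with hR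
  set r := Real.sqrt (b' ^ 2 + w' ⬝ᵥ w') with hr
  -- The test function is centred at m, so that the first variable reduces exactly to `R U₀`; the
  -- shift of the second costs at most `|m' - m|`.
  obtain ⟨c, K, hcK⟩ := exists_max_sub_le (Real.sqrt_nonneg _) hsq (abs_nonneg (m' - m))
  have hconv : ConvexOn ℝ Set.univ (fun x : ℝ => max (|x - m| - c) 0) := by
    refine ConvexOn.sup ⟨convex_univ, fun x _ y _ s t hs ht hst => ?_⟩
      (convexOn_const 0 convex_univ)
    simp only [smul_eq_mul]
    have e : s * x + t * y - m = s * (x - m) + t * (y - m) := by linear_combination m * hst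
    have habs : |s * (x - m) + t * (y - m)| ≤ s * |x - m| + t * |y - m| := by
      refine (abs_add_le _ _).trans_eq ?_
      rw [abs_mul, abs_mul, abs_of_nonneg hs, abs_of_nonneg ht]
    rw [e]
    linear_combination habs + c * hst
  have hint : ∀ (k d : ℝ) (v : Fin n → ℝ), Integrable (fun u : Unit ⊕ Fin n → ℝ =>
      max (|k + d * |u (Sum.inl ())| + v ⬝ᵥ (u ∘ Sum.inr) - m| - c) 0) (ellipticalLaw 0 1 g) :=
    fun k d v => integrable_max_abs_sub
      ((integrable_add_dotProduct hg hU k d v).sub (integrable_const m)) c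
  have hle := h _ hconv (hint m b w) (hint m' b' w')
  have e1 : ∫ u, max (|m + b * |u (Sum.inl ())| + w ⬝ᵥ (u ∘ Sum.inr) - m| - c) 0
        ∂(ellipticalLaw (0 : Unit ⊕ Fin n → ℝ) 1 g) =
      ∫ u, max (|R * u (Sum.inl ())| - c) 0 ∂(ellipticalLaw (0 : Unit ⊕ Fin n → ℝ) 1 g) := by
    rw [hR, ← integral_max_abs_sub hg hU b c w]
    refine integral_congr_ae (.of_forall fun u => ?_)
    simp only [add_assoc, add_sub_cancel_left]
  have e2 : ∫ u, max (|m' + b' * |u (Sum.inl ())| + w' ⬝ᵥ (u ∘ Sum.inr) - m| - c) 0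
        ∂(ellipticalLaw (0 : Unit ⊕ Fin n → ℝ) 1 g) ≤
      ∫ u, max (|r * u (Sum.inl ())| - (c - |m' - m|)) 0
        ∂(ellipticalLaw (0 : Unit ⊕ Fin n → ℝ) 1 g) := by
    rw [hr, ← integral_max_abs_sub hg hU b' _ w']
    refine integral_mono (hint m' b' w') (integrable_max_abs_sub
      ((hU.const_mul b').add (integrable_dotProduct_inr hg.measurable hU w')) _) fun u => ?_
    refine max_le_max_right 0 ?_
    have := abs_add_le (m' - m) (b' * |u (Sum.inl ())| + w' ⬝ᵥ (u ∘ Sum.inr))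
    rw [show m' - m + (b' * |u (Sum.inl ())| + w' ⬝ᵥ (u ∘ Sum.inr)) =
      m' + b' * |u (Sum.inl ())| + w' ⬝ᵥ (u ∘ Sum.inr) - m by ring] at this
    linarith
  have hU' : Integrable (fun u : Unit ⊕ Fin n → ℝ => u (Sum.inl ())) (ellipticalLaw 0 1 g) :=
    (integrable_norm_iff (measurable_pi_apply _).aestronglyMeasurable).mp hU
  have hiR := integrable_max_abs_sub (hU'.const_mul R) c
  have hir := integrable_max_abs_sub (hU'.const_mul r) (c - |m' - m|)
  have hpt : ∀ u : Unit ⊕ Fin n → ℝ, max (|r * u (Sum.inl ())| - (c - |m' - m|)) 0 ≤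
        max (|R * u (Sum.inl ())| - c) 0 ∧
      (max (|r * u (Sum.inl ())| - (c - |m' - m|)) 0 = max (|R * u (Sum.inl ())| - c) 0 →
        |u (Sum.inl ())| ≤ K) := fun u => by
    have := hcK _ (abs_nonneg (u (Sum.inl ())))
    rwa [abs_mul, abs_mul, abs_of_nonneg (Real.sqrt_nonneg _),
      abs_of_nonneg (Real.sqrt_nonneg _)]
  -- The order reverses the pointwise inequality of the integrands at the level of integrals, so
  -- they agree almost everywhere, which forces `|U₀| ≤ K`.
  have heq := (integral_eq_iff_of_ae_le hir hiR (.of_forall fun u => (hpt u).1)).mp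
    (le_antisymm (integral_mono hir hiR fun u => (hpt u).1) (by linarith))
  exact hunb K (heq.mono fun u hu => (hpt u).2 hu)

/-- A skew-elliptical vector is bounded if `U₀` is. -/
lemma exists_ae_norm_le {S : Type*} [MeasurableSpace S] {P : Measure S} (hg : Measurable g)
    {Om : Matrix (Fin n) (Fin n) ℝ} (hOm : Om.PosDef) {mu al : Fin n → ℝ} {X : S → Fin n → ℝ}
    (hX : HasLaw X (skewEllipticalLaw mu Om al g) P) {K : ℝ}
    (hK : ∀ᵐ u ∂(ellipticalLaw (0 : Unit ⊕ Fin n → ℝ) 1 g), |u (Sum.inl ())| ≤ K) :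
    ∃ r : ℝ, ∀ᵐ s ∂P, ‖X s‖ ≤ r := by
  obtain ⟨C, -, hlaw⟩ := exists_skewEllipticalLaw_eq_map hg hOm mu al
  have hcont : Continuous (fun v : Unit ⊕ Fin n → ℝ =>
      mu + |v (Sum.inl ())| • deltaW Om al + C *ᵥ (v ∘ Sum.inr)) := by fun_prop
  -- In the sup norm a bound on all coordinates describes a closed ball, which is compact.
  obtain ⟨r, hr⟩ := (isCompact_closedBall (0 : Unit ⊕ Fin n → ℝ) K).exists_bound_of_continuousOn
    hcont.continuousOn
  refine ⟨r, ?_⟩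
  have hmeas : MeasurableSet {x : Fin n → ℝ | ‖x‖ ≤ r} := measurableSet_le (by fun_prop) (by fun_prop)
  have h : ∀ᵐ x ∂(P.map X), ‖x‖ ≤ r := by
    rw [hX.map_eq, hlaw, ae_map_iff hcont.measurable.aemeasurable hmeas]
    filter_upwards [ae_abs_le_of_ae_abs_le hg hK] with u hu
    refine hr u (mem_closedBall_zero_iff.mpr ?_)
    exact (pi_norm_le_iff_of_nonneg ((abs_nonneg _).trans (hu (Sum.inl ())))).mpr hu
  exact (ae_map_iff hX.aemeasurable hmeas).mp h

end Necessity
end SkewElliptical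
end

open SkewElliptical in
theorem theorem3p10 {n : ℕ} {S T : Type*} [MeasurableSpace S] [MeasurableSpace T]
    (P : Measure S) (Q : Measure T) [IsProbabilityMeasure P] [IsProbabilityMeasure Q]
    (g : ℝ → ℝ) (hg : SkewElliptical.IsDensityGenerator (Unit ⊕ Fin n) g)
    (mux muy alx aly : Fin n → ℝ) (Omx Omy : Matrix (Fin n) (Fin n) ℝ)
    (hOmx : Omx.PosDef) (hOmy : Omy.PosDef)
    (X : S → Fin n → ℝ) (Y : T → Fin n → ℝ)
    (hX : HasLaw X (SkewElliptical.skewEllipticalLaw mux Omx alx g) P)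
    (hY : HasLaw Y (SkewElliptical.skewEllipticalLaw muy Omy aly g) Q) :
    (mux = muy →
      SkewElliptical.deltaW Omx alx = SkewElliptical.deltaW Omy aly →
      (Omy - Omx).PosSemidef →
      SkewElliptical.LinearConvexOrder P Q X Y) ∧
    (Integrable (fun u : ℝ => |u|) (SkewElliptical.lawU0 n g) →
      (∀ r : ℝ, ¬ ∀ᵐ s ∂P, ‖X s‖ ≤ r) →
      SkewElliptical.LinearConvexOrder P Q X Y →
      mux + (∫ u, |u| ∂(SkewElliptical.lawU0 n g)) • SkewElliptical.deltaW Omx alx =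
          muy + (∫ u, |u| ∂(SkewElliptical.lawU0 n g)) • SkewElliptical.deltaW Omy aly ∧
        (Omy - Omx).PosSemidef) := by
  have hm := hg.measurable
  have haX : ∀ a : Fin n → ℝ, AEMeasurable (fun s => a ⬝ᵥ X s) P := fun a =>
    Measurable.comp_aemeasurable (g := fun x => a ⬝ᵥ x)
      (Continuous.measurable (by fun_prop)) hX.aemeasurable
  have haY : ∀ a : Fin n → ℝ, AEMeasurable (fun s => a ⬝ᵥ Y s) Q := fun a =>
    Measurable.comp_aemeasurable (g := fun x => a ⬝ᵥ x)
      (Continuous.measurable (by fun_prop)) hY.aemeasurable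
  choose wx hwx hmapx using fun a => exists_map_dotProduct_eq hm hOmx hX a
  choose wy hwy hmapy using fun a => exists_map_dotProduct_eq hm hOmy hY a
  have hiff := fun a => convexOrder_congr (haX a) (haY a) (aemeasurable_add_dotProduct _ _ _ _)
    (aemeasurable_add_dotProduct _ _ _ _) (hmapx a) (hmapy a)
  refine ⟨fun hmu hdelta hpsd a => (hiff a).mpr ?_, fun hint hunb hord => ?_⟩
  · rw [hmu, hdelta]
    refine convexOrder_add_dotProduct hm _ _ ?_
    have h := hpsd.dotProduct_mulVec_nonneg a
    rw [star_trivial, sub_mulVec, dotProduct_sub] at h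
    rw [hwx, hwy, hdelta]
    linarith
  · have hmeas0 : AEMeasurable (fun u : Unit ⊕ Fin n → ℝ => u (Sum.inl ()))
        (ellipticalLaw 0 1 g) := (measurable_pi_apply _).aemeasurable
    have hU : Integrable (fun u : Unit ⊕ Fin n → ℝ => |u (Sum.inl ())|) (ellipticalLaw 0 1 g) :=
      (integrable_map_measure (g := fun u : ℝ => |u|) (by fun_prop) hmeas0).mp hint
    have hEU : ∫ u, |u| ∂(lawU0 n g) =
        ∫ u, |u (Sum.inl ())| ∂(ellipticalLaw (0 : Unit ⊕ Fin n → ℝ) 1 g) :=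
      integral_map (f := fun u : ℝ => |u|) hmeas0 (by fun_prop)
    rw [hEU]
    set E := ∫ u, |u (Sum.inl ())| ∂(ellipticalLaw (0 : Unit ⊕ Fin n → ℝ) 1 g)
    have hord' := fun a => (hiff a).mp (hord a)
    have hmean : ∀ a : Fin n → ℝ, a ⬝ᵥ (mux + E • deltaW Omx alx) ≤
        a ⬝ᵥ (muy + E • deltaW Omy aly) := by
      intro a
      have h := hord' a (fun x => x) (convexOn_id convex_univ)
        (integrable_add_dotProduct hg hU _ _ _) (integrable_add_dotProduct hg hU _ _ _)
      rw [integral_add_dotProduct hg hU, integral_add_dotProduct hg hU] at h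
      simp only [dotProduct_add, dotProduct_smul, smul_eq_mul]
      linarith
    refine ⟨?_, .of_dotProduct_mulVec_nonneg (hOmy.1.sub hOmx.1) fun a => ?_⟩
    -- Taking a to be the difference of the two means makes its squared length nonpositive.
    · refine sub_eq_zero.mp (dotProduct_self_eq_zero.mp (le_antisymm ?_ ?_))
      · rw [dotProduct_sub]
        exact sub_nonpos.mpr (hmean _)
      · simpa using dotProduct_star_self_nonneg
          (mux + E • deltaW Omx alx - (muy + E • deltaW Omy aly))
    · have hunb' : ∀ K : ℝ, ¬ ∀ᵐ u ∂(ellipticalLaw (0 : Unit ⊕ Fin n → ℝ) 1 g),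
          |u (Sum.inl ())| ≤ K := fun K hK => by
        obtain ⟨r, hr⟩ := exists_ae_norm_le hm hOmx hX hK
        exact hunb r hr
      have h := add_dotProduct_self_le_of_convexOrder hg hU hunb' (hord' a)
      -- The squares `(a'δ_w)²` cancel, leaving `a'Ωˣa ≤ a'Ωʸa`.
      rw [hwx, hwy] at h
      rw [star_trivial, sub_mulVec, dotProduct_sub]
      linarith
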